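/- **Theorem.** For $0\le \xi<\pi/3$ put $\alpha=e^{-i\xi}/(2\cos\xi)$ and define $f_1,f_2:\mathbb{C}\to\mathbb{C}$ by $f_1(z)=\alpha z$ and $f_2(z)=-\overline{\alpha}z+1$. Let $D_0=[0,1]\subset\mathbb{C}$ and, for $k\ge 1$, $D_k=f_1(D_{k-1})\cup f_2(D_{k-1})$. The set $D_k$ is the broken line from $0$ to $1$ consisting of $2^k$ segments whose successive vertices are $v_{k,0},\dots,v_{k,2^k}$, where $v_{0,0}=0$, $v_{0,1}=1$, and, for $k\ge 1$, $v_{k,j}=f_1(v_{k-1,j})$ for $0\le j\le 2^{k-1}$ and $v_{k,j}=f_2(v_{k-1,2^k-j})$ for $2^{k-1}\le j\le 2^k$ (the two formulas agree at $j=2^{k-1}$, where both give $\alpha$). It is called the renormalized Dragon curve of order $k$. There is a constant $\xi_0\approx 0.703858$ (correct to six decimals), namely the solution near this value of $x^6-3x^4+2x^2-1=0$ with $x=2\cos\xi_0$, such that for every integer $k\ge 1$ and every real $\xi$ with $0\le\xi<\xi_0$ the curve $D_k$ has no self-intersection: the broken line, parametrized affinely segment by segment over $[0,2^k]$, has image $D_k$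 and does not pass twice through the same point (touching at a vertex also counts as a self-intersection). -/

import Mathlib

noncomputable section

namespace Dragon

/-- The number `α = e^{-iξ} / (2 cos ξ)`. -/
def alpha (ξ : ℝ) : ℂ :=
  Complex.exp (-(Complex.I * (ξ : ℂ))) / ((2 * Real.cos ξ : ℝ) : ℂ)

/-- The map `f₁(z) = α z`. -/
def f₁ (ξ : ℝ) (z : ℂ) : ℂ := alpha ξ * z

/-- The map `f₂(z) = -ᾱ z + 1`. -/
def f₂ (ξ : ℝ) (z : ℂ) : ℂ := -(starRingEnd ℂ (alpha ξ)) * z + 1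

/-- The renormalized Dragon curve of order `k`, as a subset of the complex plane:
`D₀ = [0, 1]` and `D_k = f₁(D_{k-1}) ∪ f₂(D_{k-1})`. -/
def curve (ξ : ℝ) : ℕ → Set ℂ
  | 0 => segment ℝ (0 : ℂ) 1
  | k + 1 => f₁ ξ '' curve ξ k ∪ f₂ ξ '' curve ξ k

/-- The successive vertices `v_0 = 0, v_1, …, v_{2^k} = 1` of the renormalized Dragon curve of
order `k`. For `k + 1`, one first runs through the image under `f₁` of the vertices of order `k`
(from `f₁ 0 = 0` to `f₁ 1 = α`), then backwards through their image under `f₂`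
(from `f₂ 1 = α` to `f₂ 0 = 1`). Only the indices `j ≤ 2 ^ k` matter. -/
def vertex (ξ : ℝ) : ℕ → ℕ → ℂ
  | 0, j => (j : ℂ)
  | k + 1, j =>
      if j ≤ 2 ^ k then f₁ ξ (vertex ξ k j) else f₂ ξ (vertex ξ k (2 ^ (k + 1) - j))

/-- The broken line through the points `v 0, v 1, v 2, …`, parametrized so that it runs through
the segment from `v j` to `v (j + 1)` affinely while `t` runs through `[j, j + 1]`. -/
def brokenLine (v : ℕ → ℂ) (t : ℝ) : ℂ :=
  AffineMap.lineMap (v ⌊t⌋₊) (v (⌊t⌋₊ + 1)) (t - (⌊t⌋₊ : ℝ))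

/-- The broken line with the `n` segments `[v 0, v 1], …, [v (n - 1), v n]` has no
self-intersection: it does not pass twice through the same point (touching at a vertex counts as
a self-intersection). -/
def NoSelfIntersection (v : ℕ → ℂ) (n : ℕ) : Prop :=
  Set.InjOn (brokenLine v) (Set.Icc (0 : ℝ) (n : ℝ))

end Dragon

end

namespace Dragon

open ComplexConjugate

/-! ### The broken line through the vertices -/

/-! By induction on the order, it suffices that the two halves f₁(D_k) and f₂(D_k) meet only at α =
f₁(1) = f₂(1) (`noSelfIntersection_of_halves`).

Enclose all D_k in a region T invariant under both maps. Split each half once more: pieces from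
different halves that are not adjacent at α are disjoint because their enclosures are. The two
pieces at α meet exactly when ᾱw' + αw = 0 with w, w' in D_{k-1}. As f₁ is multiplication by α and
fixes 0, this equation reproduces itself at lower order, and descent leaves only w = w' = 0
(`eq_zero_of_endpoint`).

For T take an octagon in the coordinates x + iy tan ξ, where every condition is affine in s = tan² ξ
for fixed points. Two octagons cover 0 ≤ s ≤ 0.721, slightly beyond tan² ξ₀. The sextic therefore
serves only to locate ξ₀ and is not used in the separation. -/

theorem alpha_eq {ξ : ℝ} (h : Real.cos ξ ≠ 0) : alpha ξ = ⟨1 / 2, -Real.tan ξ / 2⟩ := by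
  have he : Complex.exp (-(Complex.I * (ξ : ℂ))) = ⟨Real.cos ξ, -Real.sin ξ⟩ := by
    have : -(Complex.I * (ξ : ℂ)) = ((-ξ : ℝ) : ℂ) * Complex.I := by push_cast; ring
    rw [this]
    apply Complex.ext
    · rw [Complex.exp_ofReal_mul_I_re, Real.cos_neg]
    · rw [Complex.exp_ofReal_mul_I_im, Real.sin_neg]
  rw [alpha, he, Real.tan_eq_sin_div_cos]
  apply Complex.ext
  · rw [Complex.div_ofReal_re]; field_simp
  · rw [Complex.div_ofReal_im]; field_simp

theorem alpha_ne_zero {ξ : ℝ} (h : Real.cos ξ ≠ 0) : alpha ξ ≠ 0 := by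
  rw [alpha_eq h]
  intro h0
  have := congrArg Complex.re h0
  norm_num at this

theorem conj_alpha {ξ : ℝ} (h : Real.cos ξ ≠ 0) : conj (alpha ξ) = 1 - alpha ξ := by
  rw [alpha_eq h]
  apply Complex.ext
  · simp; norm_num
  · simp

theorem f₁_injective {ξ : ℝ} (h : Real.cos ξ ≠ 0) : Function.Injective (f₁ ξ) :=
  mul_right_injective₀ (alpha_ne_zero h)

theorem f₂_injective {ξ : ℝ} (h : Real.cos ξ ≠ 0) : Function.Injective (f₂ ξ) := by
  intro z w hzw
  have hc : conj (alpha ξ) ≠ 0 := by simpa using alpha_ne_zero h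
  apply mul_left_cancel₀ hc
  simp only [f₂] at hzw
  linear_combination -hzw

theorem f₁_lineMap (ξ : ℝ) (a b : ℂ) (c : ℝ) :
    f₁ ξ (AffineMap.lineMap a b c) = AffineMap.lineMap (f₁ ξ a) (f₁ ξ b) c := by
  simp only [AffineMap.lineMap_apply_module', f₁, Complex.real_smul]
  ring

theorem f₂_lineMap (ξ : ℝ) (a b : ℂ) (c : ℝ) :
    f₂ ξ (AffineMap.lineMap a b c) = AffineMap.lineMap (f₂ ξ a) (f₂ ξ b) c := by
  simp only [AffineMap.lineMap_apply_module', f₂, Complex.real_smul]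
  ring

/-- The right end may be included: there the floor jumps to the next segment, which starts at the
same vertex. -/
theorem brokenLine_eq_lineMap (v : ℕ → ℂ) {j : ℕ} {t : ℝ} (h₁ : (j : ℝ) ≤ t) (h₂ : t ≤ j + 1) :
    brokenLine v t = AffineMap.lineMap (v j) (v (j + 1)) (t - j) := by
  rcases h₂.lt_or_eq with h | rfl
  · have : ⌊t⌋₊ = j := (Nat.floor_eq_iff (j.cast_nonneg.trans h₁)).2 ⟨h₁, h⟩
    rw [brokenLine, this]
  · have : ⌊(j : ℝ) + 1⌋₊ = j + 1 := by
      rw [Nat.floor_eq_iff (by positivity)]; push_cast; constructor <;> linarith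
    rw [brokenLine, this]
    simp

theorem exists_segment_index {n : ℕ} (hn : 0 < n) {t : ℝ} (h₁ : 0 ≤ t) (h₂ : t ≤ n) :
    ∃ j < n, (j : ℝ) ≤ t ∧ t ≤ j + 1 := by
  rcases h₂.lt_or_eq with h | rfl
  · exact ⟨⌊t⌋₊, (Nat.floor_lt h₁).2 h, Nat.floor_le h₁, (Nat.lt_floor_add_one t).le⟩
  · obtain ⟨m, rfl⟩ := Nat.exists_eq_succ_of_ne_zero hn.ne'
    exact ⟨m, m.lt_succ_self, by push_cast; linarith, by push_cast; linarith⟩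

theorem vertex_zero (ξ : ℝ) (k : ℕ) : vertex ξ k 0 = 0 := by
  induction k with
  | zero => simp [vertex]
  | succ k ih => simp [vertex, ih, f₁]

theorem vertex_two_pow (ξ : ℝ) (k : ℕ) : vertex ξ k (2 ^ k) = 1 := by
  cases k with
  | zero => simp [vertex]
  | succ k =>
    have : ¬ 2 ^ (k + 1) ≤ 2 ^ k := not_le.2 (Nat.pow_lt_pow_right (by norm_num) k.lt_succ_self)
    simp [vertex, this, vertex_zero, f₂]

theorem vertex_succ_left (ξ : ℝ) {k j : ℕ} (h : j ≤ 2 ^ k) :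
    vertex ξ (k + 1) j = f₁ ξ (vertex ξ k j) := by
  rw [vertex, if_pos h]

theorem vertex_succ_right {ξ : ℝ} (hc : Real.cos ξ ≠ 0) {k j : ℕ} (h : 2 ^ k ≤ j) :
    vertex ξ (k + 1) j = f₂ ξ (vertex ξ k (2 ^ (k + 1) - j)) := by
  rcases h.lt_or_eq with h | rfl
  · rw [vertex, if_neg (not_le.2 h)]
  · have : 2 ^ (k + 1) - 2 ^ k = 2 ^ k := by rw [pow_succ]; omega
    rw [vertex_succ_left ξ le_rfl, this, vertex_two_pow, f₁, f₂, conj_alpha hc]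
    ring

theorem brokenLine_succ_left (ξ : ℝ) {k : ℕ} {t : ℝ} (h₁ : 0 ≤ t) (h₂ : t ≤ (2 ^ k : ℕ)) :
    brokenLine (vertex ξ (k + 1)) t = f₁ ξ (brokenLine (vertex ξ k) t) := by
  obtain ⟨j, hj, hjt, htj⟩ := exists_segment_index (Nat.two_pow_pos k) h₁ h₂
  rw [brokenLine_eq_lineMap _ hjt htj, brokenLine_eq_lineMap _ hjt htj, f₁_lineMap,
    vertex_succ_left ξ hj.le, vertex_succ_left ξ hj]

theorem brokenLine_succ_right {ξ : ℝ} (hc : Real.cos ξ ≠ 0) {k : ℕ} {t : ℝ}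
    (h₁ : 0 ≤ t) (h₂ : t ≤ (2 ^ k : ℕ)) :
    brokenLine (vertex ξ (k + 1)) ((2 ^ (k + 1) : ℕ) - t) = f₂ ξ (brokenLine (vertex ξ k) t) := by
  obtain ⟨j, hj, hjt, htj⟩ := exists_segment_index (Nat.two_pow_pos k) h₁ h₂
  have hN : 2 ^ (k + 1) = 2 ^ k + 2 ^ k := by rw [pow_succ]; omega
  obtain ⟨i, hi⟩ : ∃ i, i + (j + 1) = 2 ^ (k + 1) := ⟨2 ^ (k + 1) - (j + 1), by omega⟩
  have hi' : ((2 ^ (k + 1) : ℕ) : ℝ) = i + (j + 1) := by rw [← hi]; push_cast; rfl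
  rw [hi', brokenLine_eq_lineMap _ hjt htj,
    brokenLine_eq_lineMap (j := i) _ (by linarith) (by linarith), f₂_lineMap,
    vertex_succ_right hc (show 2 ^ k ≤ i by omega),
    vertex_succ_right hc (show 2 ^ k ≤ i + 1 by omega),
    show 2 ^ (k + 1) - i = j + 1 by omega, show 2 ^ (k + 1) - (i + 1) = j by omega,
    ← AffineMap.lineMap_apply_one_sub]
  congr 1
  ring

theorem brokenLine_vertex_two_pow (ξ : ℝ) (k : ℕ) :
    brokenLine (vertex ξ k) ((2 ^ k : ℕ) : ℝ) = 1 := by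
  -- The segment past the last vertex is evaluated only at its start, so the meaningless next vertex
  -- plays no role.
  rw [brokenLine_eq_lineMap (j := 2 ^ k) _ le_rfl (by linarith), sub_self,
    AffineMap.lineMap_apply_zero, vertex_two_pow]

/-- A parameter of the broken line of order `k + 1` lies in the first half, or its reflection
does. -/
theorem mem_half_or {k : ℕ} {t : ℝ} (ht : t ∈ Set.Icc (0 : ℝ) ((2 ^ (k + 1) : ℕ) : ℝ)) :
    t ∈ Set.Icc (0 : ℝ) ((2 ^ k : ℕ) : ℝ) ∨
      ∃ u ∈ Set.Icc (0 : ℝ) ((2 ^ k : ℕ) : ℝ), t = (2 ^ (k + 1) : ℕ) - u := by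
  obtain ⟨h₁, h₂⟩ := ht
  rcases le_total t ((2 ^ k : ℕ) : ℝ) with h | h
  · exact .inl ⟨h₁, h⟩
  · refine .inr ⟨(2 ^ (k + 1) : ℕ) - t, ⟨by linarith, ?_⟩, by ring⟩
    push_cast [pow_succ] at *
    linarith

theorem brokenLine_image_eq_curve {ξ : ℝ} (hc : Real.cos ξ ≠ 0) (k : ℕ) :
    brokenLine (vertex ξ k) '' Set.Icc (0 : ℝ) ((2 ^ k : ℕ) : ℝ) = curve ξ k := by
  induction k with
  | zero =>
    rw [curve, segment_eq_image_lineMap]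
    simp only [pow_zero, Nat.cast_one]
    refine Set.image_congr fun t ht => ?_
    rw [brokenLine_eq_lineMap (j := 0) _ (by simpa using ht.1) (by simpa using ht.2)]
    simp [vertex]
  | succ k ih =>
    rw [curve, ← ih]
    have hN : ((2 ^ (k + 1) : ℕ) : ℝ) = (2 ^ k : ℕ) + (2 ^ k : ℕ) := by push_cast; ring
    ext z
    constructor
    · rintro ⟨t, ht, rfl⟩
      rcases mem_half_or ht with h | ⟨u, hu, rfl⟩
      · exact .inl ⟨_, ⟨t, h, rfl⟩, (brokenLine_succ_left ξ h.1 h.2).symm⟩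
      · exact .inr ⟨_, ⟨u, hu, rfl⟩, (brokenLine_succ_right hc hu.1 hu.2).symm⟩
    · rintro (⟨_, ⟨t, ht, rfl⟩, rfl⟩ | ⟨_, ⟨t, ht, rfl⟩, rfl⟩)
      · exact ⟨t, ⟨ht.1, by linarith [ht.1, ht.2]⟩, brokenLine_succ_left ξ ht.1 ht.2⟩
      · exact ⟨_, ⟨by linarith [ht.1, ht.2], by linarith [ht.1]⟩,
          brokenLine_succ_right hc ht.1 ht.2⟩

/-- The broken line has no self-intersection as soon as at every order the two halves of the curve
meet in their common endpoint only. -/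
theorem noSelfIntersection_of_halves {ξ : ℝ} (hc : Real.cos ξ ≠ 0)
    (h : ∀ k, ∀ w ∈ curve ξ k, ∀ w' ∈ curve ξ k, f₁ ξ w = f₂ ξ w' → w = 1 ∧ w' = 1) (k : ℕ) :
    NoSelfIntersection (vertex ξ k) (2 ^ k) := by
  unfold NoSelfIntersection
  induction k with
  | zero =>
    intro t ht t' ht' e
    simp only [pow_zero, Nat.cast_one] at ht ht'
    rw [brokenLine_eq_lineMap (j := 0) _ (by simpa using ht.1) (by simpa using ht.2),
      brokenLine_eq_lineMap (j := 0) _ (by simpa using ht'.1) (by simpa using ht'.2)] at e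
    simpa [vertex, AffineMap.lineMap_apply] using e
  | succ k ih =>
    have mixed : ∀ t ∈ Set.Icc (0 : ℝ) ((2 ^ k : ℕ) : ℝ), ∀ u ∈ Set.Icc (0 : ℝ) ((2 ^ k : ℕ) : ℝ),
        brokenLine (vertex ξ (k + 1)) t =
          brokenLine (vertex ξ (k + 1)) ((2 ^ (k + 1) : ℕ) - u) →
        t = (2 ^ (k + 1) : ℕ) - u := by
      intro t ht u hu e
      rw [brokenLine_succ_left ξ ht.1 ht.2, brokenLine_succ_right hc hu.1 hu.2] at e
      have mem : ∀ r ∈ Set.Icc (0 : ℝ) ((2 ^ k : ℕ) : ℝ),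
          brokenLine (vertex ξ k) r ∈ curve ξ k := fun r hr => by
        rw [← brokenLine_image_eq_curve hc]; exact Set.mem_image_of_mem _ hr
      have hlast : ((2 ^ k : ℕ) : ℝ) ∈ Set.Icc (0 : ℝ) ((2 ^ k : ℕ) : ℝ) :=
        ⟨Nat.cast_nonneg _, le_rfl⟩
      -- Both points equal 1, the value at `2 ^ k`, so injectivity at order k forces t = u = `2 ^
      -- k`.
      obtain ⟨e₁, e₂⟩ := h k _ (mem t ht) _ (mem u hu) e
      rw [← brokenLine_vertex_two_pow ξ k] at e₁ e₂
      rw [ih ht hlast e₁, ih hu hlast e₂]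
      push_cast
      ring
    intro t ht t' ht' e
    rcases mem_half_or ht with h₁ | ⟨u, hu, rfl⟩ <;> rcases mem_half_or ht' with h₂ | ⟨u', hu', rfl⟩
    · rw [brokenLine_succ_left ξ h₁.1 h₁.2, brokenLine_succ_left ξ h₂.1 h₂.2] at e
      exact ih h₁ h₂ (f₁_injective hc e)
    · exact mixed t h₁ u' hu' e
    · exact (mixed t' h₂ u hu e.symm).symm
    · rw [brokenLine_succ_right hc hu.1 hu.2, brokenLine_succ_right hc hu'.1 hu'.2] at e
      rw [ih hu hu' (f₂_injective hc e)]

/-! ### Separation by an invariant region -/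

/-- A region that contains `[0, 1]` and is mapped into itself by `f₁` and `f₂`, with the
non-adjacent pieces of the second generation disjoint, and such that at the endpoint `0` the region
rotated by `-α / ᾱ` misses its image under `f₂`, and likewise with the roles exchanged. -/
structure IsSeparatingRegion (ξ : ℝ) (T : Set ℂ) : Prop where
  segment_subset : segment ℝ (0 : ℂ) 1 ⊆ T
  f₁_mem : ∀ w ∈ T, f₁ ξ w ∈ T
  f₂_mem : ∀ w ∈ T, f₂ ξ w ∈ T
  endpoint : ∀ w ∈ T, ∀ w' ∈ T, conj (alpha ξ) * f₂ ξ w + alpha ξ * w' ≠ 0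
  endpoint' : ∀ w ∈ T, ∀ w' ∈ T, conj (alpha ξ) * w + alpha ξ * f₂ ξ w' ≠ 0
  f₁_f₁_ne_f₂_f₁ : ∀ w ∈ T, ∀ w' ∈ T, f₁ ξ (f₁ ξ w) ≠ f₂ ξ (f₁ ξ w')
  f₁_f₁_ne_f₂_f₂ : ∀ w ∈ T, ∀ w' ∈ T, f₁ ξ (f₁ ξ w) ≠ f₂ ξ (f₂ ξ w')
  f₁_f₂_ne_f₂_f₁ : ∀ w ∈ T, ∀ w' ∈ T, f₁ ξ (f₂ ξ w) ≠ f₂ ξ (f₁ ξ w')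

theorem mem_segment_zero_one {z : ℂ} (h : z ∈ segment ℝ (0 : ℂ) 1) :
    0 ≤ z.re ∧ z.re ≤ 1 ∧ z.im = 0 := by
  rw [segment_eq_image_lineMap] at h
  obtain ⟨t, ht, rfl⟩ := h
  simpa [AffineMap.lineMap_apply] using ht

namespace IsSeparatingRegion

variable {ξ : ℝ} {T : Set ℂ}

theorem curve_subset (hT : IsSeparatingRegion ξ T) (k : ℕ) : curve ξ k ⊆ T := by
  induction k with
  | zero => exact hT.segment_subset
  | succ k ih =>
    rintro _ (⟨w, hw, rfl⟩ | ⟨w, hw, rfl⟩)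
    · exact hT.f₁_mem w (ih hw)
    · exact hT.f₂_mem w (ih hw)

theorem eq_zero_of_endpoint (hc : Real.cos ξ ≠ 0) (hT : IsSeparatingRegion ξ T) (k : ℕ) :
    ∀ w ∈ curve ξ k, ∀ w' ∈ curve ξ k, conj (alpha ξ) * w + alpha ξ * w' = 0 →
      w = 0 ∧ w' = 0 := by
  induction k with
  | zero =>
    intro w hw w' hw' e
    obtain ⟨h₁, -, h₂⟩ := mem_segment_zero_one hw
    obtain ⟨h₁', -, h₂'⟩ := mem_segment_zero_one hw'
    have hre := congrArg Complex.re e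
    simp [alpha_eq hc, h₂, h₂'] at hre
    exact ⟨Complex.ext (by simp; linarith) h₂, Complex.ext (by simp; linarith) h₂'⟩
  | succ k ih =>
    have hsub := hT.curve_subset k
    rintro _ (⟨w, hw, rfl⟩ | ⟨w, hw, rfl⟩) _ (⟨w', hw', rfl⟩ | ⟨w', hw', rfl⟩) e
    -- Both points lie in f₁-pieces: a common factor α cancels and the order drops by one.
    · have : conj (alpha ξ) * w + alpha ξ * w' = 0 := by
        apply mul_left_cancel₀ (alpha_ne_zero hc)
        simp only [f₁] at e
        linear_combination e
      obtain ⟨rfl, rfl⟩ := ih w hw w' hw' this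
      simp [f₁]
    · exact absurd e (hT.endpoint' _ (hT.f₁_mem w (hsub hw)) w' (hsub hw'))
    · exact absurd e (hT.endpoint w (hsub hw) _ (hT.f₁_mem w' (hsub hw')))
    · exact absurd e (hT.endpoint w (hsub hw) _ (hT.f₂_mem w' (hsub hw')))

theorem eq_one_of_halves (hc : Real.cos ξ ≠ 0) (hT : IsSeparatingRegion ξ T) (k : ℕ) :
    ∀ w ∈ curve ξ k, ∀ w' ∈ curve ξ k, f₁ ξ w = f₂ ξ w' → w = 1 ∧ w' = 1 := by
  cases k with
  | zero =>
    intro w hw w' hw' e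
    obtain ⟨-, h₁, h₂⟩ := mem_segment_zero_one hw
    obtain ⟨-, h₁', h₂'⟩ := mem_segment_zero_one hw'
    have hre := congrArg Complex.re e
    simp [f₁, f₂, alpha_eq hc, h₂, h₂'] at hre
    exact ⟨Complex.ext (by simp; linarith) h₂, Complex.ext (by simp; linarith) h₂'⟩
  | succ k =>
    have hsub := hT.curve_subset k
    rintro _ (⟨w, hw, rfl⟩ | ⟨w, hw, rfl⟩) _ (⟨w', hw', rfl⟩ | ⟨w', hw', rfl⟩) e
    · exact absurd e (hT.f₁_f₁_ne_f₂_f₁ w (hsub hw) w' (hsub hw'))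
    · exact absurd e (hT.f₁_f₁_ne_f₂_f₂ w (hsub hw) w' (hsub hw'))
    · exact absurd e (hT.f₁_f₂_ne_f₂_f₁ w (hsub hw) w' (hsub hw'))
    -- The pieces adjacent at α: expanding f₁f₂w = f₂f₂w' and cancelling ᾱ gives the endpoint
    -- equation.
    · have hconj : conj (alpha ξ) ≠ 0 := by simpa using alpha_ne_zero hc
      have : conj (alpha ξ) * w' + alpha ξ * w = 0 := by
        apply mul_left_cancel₀ hconj
        simp only [f₁, f₂] at e
        linear_combination -e + conj_alpha hc
      obtain ⟨rfl, rfl⟩ := hT.eq_zero_of_endpoint hc k w' hw' w hw this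
      simp [f₂]

/-- A separating region given by a predicate `P` on the coordinates `(x, y)` of the points
`x + i y tan ξ`; in these coordinates `f₁` and `f₂` are affine in `s = tan² ξ`. -/
theorem of_coordinates {P : ℝ → ℝ → Prop} {t s : ℝ} (hc : Real.cos ξ ≠ 0) (ht : Real.tan ξ = t)
    (hs : s = t ^ 2)
    (segment : ∀ x, 0 ≤ x → x ≤ 1 → P x 0)
    (map₁ : ∀ x y, P x y → P ((x + s * y) / 2) ((y - x) / 2))
    (map₂ : ∀ x y, P x y → P ((2 - x + s * y) / 2) ((-y - x) / 2))
    (endpoint : ∀ x y a b, P x y → P a b → 1 - x / 2 + s * y + s * x / 2 + a + s * b = 0 →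
      t * (1 - x + s * y / 2 - y / 2 + b - a) ≠ 0)
    (endpoint' : ∀ x y a b, P x y → P a b → 1 - (1 + s) * x / 2 + a - s * b = 0 →
      t * (-1 - y / 2 - s * y / 2 + a + b) ≠ 0)
    (cross₁₁ : ∀ x y a b, P x y → P a b → x / 2 + s * y - s * x / 2 + a / 2 + s * a / 2 - 2 = 0 →
      t * (y / 2 - x - s * y / 2 + b / 2 + s * b / 2) ≠ 0)
    (cross₁₂ : ∀ x y a b, P x y → P a b →
      x / 2 + s * y - s * x / 2 - 1 - a / 2 + s * b + s * a / 2 = 0 →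
      t * (y / 2 - x - s * y / 2 + 1 - a + s * b / 2 - b / 2) ≠ 0)
    (cross₂₁ : ∀ x y a b, P x y → P a b → -1 - x / 2 - s * x / 2 + a / 2 + s * a / 2 = 0 →
      t * (-1 - y / 2 - s * y / 2 + b / 2 + s * b / 2) ≠ 0) :
    -- Quantifying over y instead of dividing by t keeps ξ = 0 admissible.
    IsSeparatingRegion ξ {z | ∃ y, z.im = t * y ∧ P z.re y} where
  segment_subset z hz := by
    obtain ⟨h₀, h₁, h₂⟩ := mem_segment_zero_one hz
    exact ⟨0, by simp [h₂], segment _ h₀ h₁⟩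
  f₁_mem := by
    rintro ⟨x, _⟩ ⟨y, rfl, h⟩
    refine ⟨(y - x) / 2, ?_, ?_⟩
    · simp [f₁, alpha_eq hc, ht]; ring
    · convert map₁ x y h using 1
      simp [f₁, alpha_eq hc, ht, hs]; ring
  f₂_mem := by
    rintro ⟨x, _⟩ ⟨y, rfl, h⟩
    refine ⟨(-y - x) / 2, ?_, ?_⟩
    · simp [f₂, alpha_eq hc, ht]; ring
    · convert map₂ x y h using 1
      simp [f₂, alpha_eq hc, ht, hs]; ring
  endpoint := by
    rintro ⟨x, _⟩ ⟨y, rfl, h⟩ ⟨a, _⟩ ⟨b, rfl, h'⟩ e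
    have e₁ := congrArg Complex.re e
    have e₂ := congrArg Complex.im e
    simp [f₂, alpha_eq hc, ht] at e₁ e₂
    subst hs
    exact endpoint x y a b h h' (by linear_combination 2 * e₁) (by linear_combination 2 * e₂)
  endpoint' := by
    rintro ⟨a, _⟩ ⟨b, rfl, h'⟩ ⟨x, _⟩ ⟨y, rfl, h⟩ e
    have e₁ := congrArg Complex.re e
    have e₂ := congrArg Complex.im e
    simp [f₂, alpha_eq hc, ht] at e₁ e₂
    subst hs
    exact endpoint' x y a b h h' (by linear_combination 2 * e₁) (by linear_combination 2 * e₂)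
  f₁_f₁_ne_f₂_f₁ := by
    rintro ⟨x, _⟩ ⟨y, rfl, h⟩ ⟨a, _⟩ ⟨b, rfl, h'⟩ e
    have e₁ := congrArg Complex.re e
    have e₂ := congrArg Complex.im e
    simp [f₁, f₂, alpha_eq hc, ht] at e₁ e₂
    subst hs
    exact cross₁₁ x y a b h h' (by linear_combination 2 * e₁) (by linear_combination 2 * e₂)
  f₁_f₁_ne_f₂_f₂ := by
    rintro ⟨x, _⟩ ⟨y, rfl, h⟩ ⟨a, _⟩ ⟨b, rfl, h'⟩ e
    have e₁ := congrArg Complex.re e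
    have e₂ := congrArg Complex.im e
    simp [f₁, f₂, alpha_eq hc, ht] at e₁ e₂
    subst hs
    exact cross₁₂ x y a b h h' (by linear_combination 2 * e₁) (by linear_combination 2 * e₂)
  f₁_f₂_ne_f₂_f₁ := by
    rintro ⟨x, _⟩ ⟨y, rfl, h⟩ ⟨a, _⟩ ⟨b, rfl, h'⟩ e
    have e₁ := congrArg Complex.re e
    have e₂ := congrArg Complex.im e
    simp [f₁, f₂, alpha_eq hc, ht] at e₁ e₂
    subst hs
    exact cross₂₁ x y a b h h' (by linear_combination 2 * e₁) (by linear_combination 2 * e₂)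

end IsSeparatingRegion

/-! ### Octagonal separating regions -/

/-- Reduces a bilinear inequality to two linear ones, at the ends of the range of s. -/
theorem add_mul_pos_of_mem_Icc {l u s p q : ℝ} (hl : l ≤ s) (hu : s ≤ u) (h₁ : 0 < p + l * q)
    (h₂ : 0 < p + u * q) : 0 < p + s * q := by
  rcases le_total 0 q with h | h <;> nlinarith

/-- The octagon with sides parallel to the axes and the diagonals, given by its support numbers. -/
structure InOctagon (c₁ c₂ c₃ c₄ c₅ c₆ c₇ c₈ x y : ℝ) : Prop where
  x_le : x ≤ c₁
  neg_x_le : -x ≤ c₂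
  y_le : y ≤ c₃
  neg_y_le : -y ≤ c₄
  add_le : x + y ≤ c₅
  neg_add_le : -x - y ≤ c₆
  sub_le : x - y ≤ c₇
  neg_sub_le : y - x ≤ c₈

namespace IsSeparatingRegion

/-- For small `tan² ξ` the first coordinate alone separates. -/
theorem exists_of_tan_sq_le {ξ : ℝ} (hc : Real.cos ξ ≠ 0) (hl : 0 ≤ Real.tan ξ ^ 2)
    (hu : Real.tan ξ ^ 2 ≤ 2 / 5) : ∃ T, IsSeparatingRegion ξ T := by
  obtain ⟨s, hs⟩ : ∃ s, s = Real.tan ξ ^ 2 := ⟨_, rfl⟩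
  rw [← hs] at hl hu
  refine ⟨_, of_coordinates (P := InOctagon (22 / 20) (3 / 20) (5 / 20) (14 / 20) (27 / 20) (10 / 20) (24 / 20) (3 / 20)) hc rfl hs
    ?_ ?_ ?_ ?_ ?_ ?_ ?_ ?_⟩
  · intro x h₀ h₁
    constructor <;> linarith
  · rintro x y ⟨h₁, h₂, h₃, h₄, h₅, h₆, h₇, h₈⟩
    rcases le_total 0 y with hy | hy
    · have := mul_le_mul_of_nonneg_right hl hy
      have := mul_le_mul_of_nonneg_right hu hy
      constructor <;> linarith
    · have := mul_le_mul_of_nonpos_right hl hy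
      have := mul_le_mul_of_nonpos_right hu hy
      constructor <;> linarith
  · rintro x y ⟨h₁, h₂, h₃, h₄, h₅, h₆, h₇, h₈⟩
    rcases le_total 0 y with hy | hy
    · have := mul_le_mul_of_nonneg_right hl hy
      have := mul_le_mul_of_nonneg_right hu hy
      constructor <;> linarith
    · have := mul_le_mul_of_nonpos_right hl hy
      have := mul_le_mul_of_nonpos_right hu hy
      constructor <;> linarith
  · rintro x y a b ⟨h₁, h₂, h₃, h₄, h₅, h₆, h₇, h₈⟩ ⟨g₁, g₂, g₃, g₄, g₅, g₆, g₇, g₈⟩ e₁ -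
    have := add_mul_pos_of_mem_Icc (p := (1 - x / 2 + a))
      (q := (y + x / 2 + b)) hl hu (by linarith) (by linarith)
    linarith
  · rintro x y a b ⟨h₁, h₂, h₃, h₄, h₅, h₆, h₇, h₈⟩ ⟨g₁, g₂, g₃, g₄, g₅, g₆, g₇, g₈⟩ e₁ -
    have := add_mul_pos_of_mem_Icc (p := (1 - x / 2 + a))
      (q := (-x / 2 - b)) hl hu (by linarith) (by linarith)
    linarith
  · rintro x y a b ⟨h₁, h₂, h₃, h₄, h₅, h₆, h₇, h₈⟩ ⟨g₁, g₂, g₃, g₄, g₅, g₆, g₇, g₈⟩ e₁ -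
    have := add_mul_pos_of_mem_Icc (p := -(x / 2 + a / 2 - 2))
      (q := -(y - x / 2 + a / 2)) hl hu (by linarith) (by linarith)
    linarith
  · rintro x y a b ⟨h₁, h₂, h₃, h₄, h₅, h₆, h₇, h₈⟩ ⟨g₁, g₂, g₃, g₄, g₅, g₆, g₇, g₈⟩ e₁ -
    have := add_mul_pos_of_mem_Icc (p := -(x / 2 - 1 - a / 2))
      (q := -(y - x / 2 + b + a / 2)) hl hu (by linarith) (by linarith)
    linarith
  · rintro x y a b ⟨h₁, h₂, h₃, h₄, h₅, h₆, h₇, h₈⟩ ⟨g₁, g₂, g₃, g₄, g₅, g₆, g₇, g₈⟩ e₁ -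
    have := add_mul_pos_of_mem_Icc (p := -(-1 - x / 2 + a / 2))
      (q := -(-x / 2 + a / 2)) hl hu (by linarith) (by linarith)
    linarith

/-- The region for the larger values of `tan² ξ`. -/
theorem exists_of_le_tan_sq {ξ : ℝ} (hc : Real.cos ξ ≠ 0) (hl : 2 / 5 ≤ Real.tan ξ ^ 2)
    (hu : Real.tan ξ ^ 2 ≤ 721 / 1000) : ∃ T, IsSeparatingRegion ξ T := by
  obtain ⟨s, hs⟩ : ∃ s, s = Real.tan ξ ^ 2 := ⟨_, rfl⟩
  rw [← hs] at hl hu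
  -- Now the imaginary equation can be divided by tan ξ and used too.
  have ht : Real.tan ξ ≠ 0 := by
    intro h
    rw [hs, h] at hl
    norm_num at hl
  refine ⟨_, of_coordinates (P := InOctagon (561 / 500) (122 / 500) (145 / 500) (337 / 500) (673 / 500) (290 / 500) (625 / 500) (122 / 500)) hc rfl hs
    ?_ ?_ ?_ ?_ ?_ ?_ ?_ ?_⟩
  · intro x h₀ h₁
    constructor <;> linarith
  · rintro x y ⟨h₁, h₂, h₃, h₄, h₅, h₆, h₇, h₈⟩
    rcases le_total 0 y with hy | hy
    · have := mul_le_mul_of_nonneg_right hl hy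
      have := mul_le_mul_of_nonneg_right hu hy
      constructor <;> linarith
    · have := mul_le_mul_of_nonpos_right hl hy
      have := mul_le_mul_of_nonpos_right hu hy
      constructor <;> linarith
  · rintro x y ⟨h₁, h₂, h₃, h₄, h₅, h₆, h₇, h₈⟩
    rcases le_total 0 y with hy | hy
    · have := mul_le_mul_of_nonneg_right hl hy
      have := mul_le_mul_of_nonneg_right hu hy
      constructor <;> linarith
    · have := mul_le_mul_of_nonpos_right hl hy
      have := mul_le_mul_of_nonpos_right hu hy
      constructor <;> linarith
  · rintro x y a b ⟨h₁, h₂, h₃, h₄, h₅, h₆, h₇, h₈⟩ ⟨g₁, g₂, g₃, g₄, g₅, g₆, g₇, g₈⟩ e₁ e₂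
    replace e₂ := (mul_eq_zero.1 e₂).resolve_left ht
    -- The factor 7/50 tilts the separating direction: real equation plus a multiple of the
    -- imaginary one. The factors below do the same.
    have := add_mul_pos_of_mem_Icc (p := (1 - x / 2 + a) + 7 / 50 * (1 - x - y / 2 + b - a))
      (q := (y + x / 2 + b) + 7 / 50 * (y / 2)) hl hu (by linarith) (by linarith)
    linarith
  · rintro x y a b ⟨h₁, h₂, h₃, h₄, h₅, h₆, h₇, h₈⟩ ⟨g₁, g₂, g₃, g₄, g₅, g₆, g₇, g₈⟩ e₁ e₂
    replace e₂ := (mul_eq_zero.1 e₂).resolve_left ht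
    have := add_mul_pos_of_mem_Icc (p := (1 - x / 2 + a) - (-1 - y / 2 + a + b))
      (q := (-x / 2 - b) - (-y / 2)) hl hu (by linarith) (by linarith)
    linarith
  · rintro x y a b ⟨h₁, h₂, h₃, h₄, h₅, h₆, h₇, h₈⟩ ⟨g₁, g₂, g₃, g₄, g₅, g₆, g₇, g₈⟩ e₁ e₂
    replace e₂ := (mul_eq_zero.1 e₂).resolve_left ht
    have := add_mul_pos_of_mem_Icc (p := -(x / 2 + a / 2 - 2) - 1 / 10 * (y / 2 - x + b / 2))
      (q := -(y - x / 2 + a / 2) - 1 / 10 * (-y / 2 + b / 2)) hl hu (by linarith) (by linarith)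
    linarith
  · rintro x y a b ⟨h₁, h₂, h₃, h₄, h₅, h₆, h₇, h₈⟩ ⟨g₁, g₂, g₃, g₄, g₅, g₆, g₇, g₈⟩ e₁ e₂
    replace e₂ := (mul_eq_zero.1 e₂).resolve_left ht
    have := add_mul_pos_of_mem_Icc (p := -(x / 2 - 1 - a / 2) - 1 / 10 * (y / 2 - x + 1 - a - b / 2))
      (q := -(y - x / 2 + b + a / 2) - 1 / 10 * (-y / 2 + b / 2)) hl hu (by linarith) (by linarith)
    linarith
  · rintro x y a b ⟨h₁, h₂, h₃, h₄, h₅, h₆, h₇, h₈⟩ ⟨g₁, g₂, g₃, g₄, g₅, g₆, g₇, g₈⟩ e₁ e₂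
    replace e₂ := (mul_eq_zero.1 e₂).resolve_left ht
    have := add_mul_pos_of_mem_Icc (p := -(-1 - x / 2 + a / 2) - (-1 - y / 2 + b / 2))
      (q := -(-x / 2 + a / 2) - (-y / 2 + b / 2)) hl hu (by linarith) (by linarith)
    linarith

end IsSeparatingRegion

/-! ### The critical angle -/

/-- Real part of the exponential remainder at ix after 10 terms; the constant is 11 / (10! · 10). -/
theorem abs_cos_sub_taylor_le {x : ℝ} (hx : |x| ≤ 1) :
    |Real.cos x - (1 - x ^ 2 / 2 + x ^ 4 / 24 - x ^ 6 / 720 + x ^ 8 / 40320)| ≤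
      |x| ^ 10 * (11 / 36288000) := by
  have h := Complex.exp_bound (x := x * Complex.I) (by simpa using hx) (n := 10) (by norm_num)
  have hsum : (Complex.exp (x * Complex.I) -
      ∑ m ∈ Finset.range 10, (x * Complex.I) ^ m / (m.factorial : ℂ)).re =
      Real.cos x - (1 - x ^ 2 / 2 + x ^ 4 / 24 - x ^ 6 / 720 + x ^ 8 / 40320) := by
    have hpoly : ∑ m ∈ Finset.range 10, (x * Complex.I) ^ m / (m.factorial : ℂ) =
        ((1 - x ^ 2 / 2 + x ^ 4 / 24 - x ^ 6 / 720 + x ^ 8 / 40320 : ℝ) : ℂ) +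
        ((x - x ^ 3 / 6 + x ^ 5 / 120 - x ^ 7 / 5040 + x ^ 9 / 362880 : ℝ) : ℂ) * Complex.I := by
      have h2 : Complex.I ^ 2 = -1 := Complex.I_sq
      have h3 : Complex.I ^ 3 = -Complex.I := Complex.I_pow_three
      have h4 : Complex.I ^ 4 = 1 := Complex.I_pow_four
      have h5 : Complex.I ^ 5 = Complex.I := by rw [pow_succ, h4, one_mul]
      have h6 : Complex.I ^ 6 = -1 := by rw [pow_succ, h5, Complex.I_mul_I]
      have h7 : Complex.I ^ 7 = -Complex.I := by rw [pow_succ, h6]; ring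
      have h8 : Complex.I ^ 8 = 1 := by rw [pow_succ, h7, neg_mul, Complex.I_mul_I, neg_neg]
      have h9 : Complex.I ^ 9 = Complex.I := by rw [pow_succ, h8, one_mul]
      simp only [Finset.sum_range_succ, Finset.sum_range_zero, mul_pow, h2, h3, h4, h5, h6, h7, h8,
        h9, Nat.factorial]
      push_cast
      ring
    rw [Complex.sub_re, Complex.exp_ofReal_mul_I_re, hpoly, Complex.add_re, Complex.ofReal_re,
      Complex.re_ofReal_mul, Complex.I_re]
    ring
  rw [← hsum]
  refine (Complex.abs_re_le_norm _).trans (h.trans (le_of_eq ?_))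
  rw [norm_mul, Complex.norm_I, mul_one, Complex.norm_real, Real.norm_eq_abs]
  norm_num [Nat.factorial]

/-- The derivative 3y² − 6y + 2 is positive beyond 1 + 1/√3 < 1.6; here y stands for 4cos² ξ. -/
theorem criticalCubic_mono {y z : ℝ} (hy : 1.6 ≤ y) (hyz : y ≤ z) :
    y ^ 3 - 3 * y ^ 2 + 2 * y ≤ z ^ 3 - 3 * z ^ 2 + 2 * z := by
  have : 0 ≤ (z - y) * (z ^ 2 + z * y + y ^ 2 - 3 * (z + y) + 2) := by
    apply mul_nonneg (by linarith)
    nlinarith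
  linarith

theorem exists_critical_angle :
    ∃ ξ₀ ∈ Set.Icc (0.7038575 : ℝ) 0.703858,
      (2 * Real.cos ξ₀) ^ 6 - 3 * (2 * Real.cos ξ₀) ^ 4 + 2 * (2 * Real.cos ξ₀) ^ 2 - 1 = 0 := by
  have hl : (0.7623514 : ℝ) ≤ Real.cos 0.7038575 := by
    have := (abs_le.1 (abs_cos_sub_taylor_le (x := 0.7038575) (by norm_num [abs_le]))).1
    norm_num [abs_of_pos] at this ⊢
    linarith
  have hu : Real.cos 0.703858 ≤ 0.7623512 := by
    have := (abs_le.1 (abs_cos_sub_taylor_le (x := 0.703858) (by norm_num [abs_le]))).2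
    norm_num [abs_of_pos] at this ⊢
    linarith
  have hu' : 0 < Real.cos 0.703858 :=
    Real.cos_pos_of_le_one (by norm_num [abs_le])
  have key := intermediate_value_Icc' (f := fun ξ : ℝ =>
    (2 * Real.cos ξ) ^ 6 - 3 * (2 * Real.cos ξ) ^ 4 + 2 * (2 * Real.cos ξ) ^ 2 - 1)
    (show (0.7038575 : ℝ) ≤ 0.703858 by norm_num) (by fun_prop)
  obtain ⟨ξ₀, hξ₀, h⟩ := key (show (0 : ℝ) ∈ _ by
    constructor
    · have h₁ : Real.cos 0.703858 ^ 2 ≤ 0.7623512 ^ 2 := pow_le_pow_left₀ hu'.le hu 2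
      have h₂ : (2 / 3 : ℝ) ^ 2 ≤ Real.cos 0.703858 ^ 2 := pow_le_pow_left₀ (by norm_num)
        (by linarith [Real.one_sub_sq_div_two_le_cos (x := 0.703858)]) 2
      have h₃ := criticalCubic_mono (by linarith) (mul_le_mul_of_nonneg_left h₁ (four_pos).le)
      norm_num at h₃ ⊢
      linarith
    · have h₁ : (0.7623514 : ℝ) ^ 2 ≤ Real.cos 0.7038575 ^ 2 :=
        pow_le_pow_left₀ (by norm_num) hl 2
      have h₃ := criticalCubic_mono (by norm_num) (mul_le_mul_of_nonneg_left h₁ (four_pos).le)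
      norm_num at h₃ ⊢
      linarith)
  exact ⟨ξ₀, hξ₀, h⟩

theorem cos_pos_and_tan_sq_le {ξ : ℝ} (h₀ : 0 ≤ ξ) (h₁ : ξ ≤ 0.703858) :
    0 < Real.cos ξ ∧ Real.tan ξ ^ 2 ≤ 721 / 1000 := by
  have hl : (0.76235 : ℝ) ≤ Real.cos 0.703858 := by
    have := (abs_le.1 (abs_cos_sub_taylor_le (x := 0.703858) (by norm_num [abs_le]))).1
    norm_num [abs_of_pos] at this ⊢
    linarith
  have hcos : (0.76235 : ℝ) ≤ Real.cos ξ :=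
    hl.trans (Real.cos_le_cos_of_nonneg_of_le_pi h₀ (by linarith [Real.pi_gt_three]) h₁)
  have hpos : 0 < Real.cos ξ := lt_of_lt_of_le (by norm_num) hcos
  refine ⟨hpos, ?_⟩
  rw [Real.tan_eq_sin_div_cos, div_pow, div_le_iff₀ (by positivity), Real.sin_sq]
  nlinarith

end Dragon

theorem theorem2 :
    ∃ ξ₀ : ℝ,
      |ξ₀ - 0.703858| ≤ 0.0000005 ∧
      (2 * Real.cos ξ₀) ^ 6 - 3 * (2 * Real.cos ξ₀) ^ 4 + 2 * (2 * Real.cos ξ₀) ^ 2 - 1 = 0 ∧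
      ∀ k : ℕ, 1 ≤ k → ∀ ξ : ℝ, 0 ≤ ξ → ξ < ξ₀ →
        Dragon.brokenLine (Dragon.vertex ξ k) '' Set.Icc (0 : ℝ) ((2 ^ k : ℕ) : ℝ)
            = Dragon.curve ξ k ∧
        Dragon.NoSelfIntersection (Dragon.vertex ξ k) (2 ^ k) := by
  obtain ⟨ξ₀, ⟨hl, hu⟩, hroot⟩ := Dragon.exists_critical_angle
  refine ⟨ξ₀, abs_le.2 ⟨by linarith, by linarith⟩, hroot, fun k _ ξ h₀ h₁ => ?_⟩
  obtain ⟨hcos, htan⟩ := Dragon.cos_pos_and_tan_sq_le h₀ (h₁.le.trans hu)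
  obtain ⟨T, hT⟩ : ∃ T, Dragon.IsSeparatingRegion ξ T := by
    rcases le_total (Real.tan ξ ^ 2) (2 / 5) with h | h
    · exact Dragon.IsSeparatingRegion.exists_of_tan_sq_le hcos.ne' (sq_nonneg _) h
    · exact Dragon.IsSeparatingRegion.exists_of_le_tan_sq hcos.ne' h htan
  exact ⟨Dragon.brokenLine_image_eq_curve hcos.ne' k,
    Dragon.noSelfIntersection_of_halves hcos.ne' (hT.eq_one_of_halves hcos.ne') k⟩
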